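/- Let $\alpha\in(0,1]$, $\lambda>0$, $\mu>0$, $\xi\ge 0$. Let $\{X^\alpha_t\}_{t\ge 0}$ be the fractional $M/M/1$ queue with catastrophes, that is, an $\mathbb{N}_0$-valued stochastic process on a probability space such that, for every $i$ with $P(X^\alpha_0=i)>0$, the transition probabilities $P^\alpha_{i,n}(t):=P(X^\alpha_t=n\mid X^\alpha_0=i)$ are continuous in $t\ge 0$ and satisfy, for all $t>0$ and $n\ge 1$, $$D^\alpha_tP^\alpha_{i,0}(t)=-(\lambda+\xi)P^\alpha_{i,0}(t)+\mu P^\alpha_{i,1}(t)+\xi,$$ $$D^\alpha_tP^\alpha_{i,n}(t)=-(\lambda+\mu+\xi)P^\alpha_{i,n}(t)+\lambda P^\alpha_{i,n-1}(t)+\mu P^\alpha_{i,n+1}(t),$$ with $P^\alpha_{i,n}(0)=\delta_{i,n}$ for all $n\ge0$. Here $D^\alpha_t$ is the Caputo derivative, $D^\alpha_tf=\frac{d}{dt}J^{1-\alpha}(f-f(0))$, where $J^af(t)=\frac1{\Gamma(a)}\int_0^t(t-s)^{a-1}f(s)\,ds$ for $a>0$ and $J^0f=f$ (so $D^1_t=d/dt$).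 Let $$E^\delta_{\beta,\gamma}(w)=\sum_{r=0}^\infty\frac{w^r\,\Gamma(\delta+r)}{r!\,\Gamma(\beta r+\gamma)\,\Gamma(\delta)}$$ be the three-parameter Mittag-Leffler function and $(f\ast g)(t)=\int_0^tf(s)g(t-s)\,ds$. Then for every $t\ge0$ and every $i$ with $P(X^\alpha_0=i)>0$, the expectation $\mathbb{E}[X^\alpha_t]$ of the process started at $i$ (that is, under $P(\,\cdot\mid X^\alpha_0=i)$) is finite, the convolution below converges absolutely, and, if $\xi>0$, $$\mathbb{E}[X^\alpha_t]=i\,E^1_{\alpha,1}(-\xi t^\alpha)+\mu\,\bigl[P^\alpha_{i,0}\ast s^{\alpha-1}E^1_{\alpha,\alpha}(-\xi s^\alpha)\bigr](t)+\frac{\lambda-\mu}{\xi}\bigl(1-E^1_{\alpha,1}(-\xi t^\alpha)\bigr).$$ If $\xi=0$, then $$\mathbb{E}[X^\alpha_t]=i+\mu\,J^\alpha P^\alpha_{i,0}(t)+\frac{(\lambda-\mu)t^\alpha}{\Gamma(\alpha+1)}.$$ If $\alpha=1$ and $\xi>0$, then $$\mathbb{E}[X^1_t]=i\,e^{-\xi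 t}+\mu\int_0^tP^1_{i,0}(s)\,e^{-\xi(t-s)}\,ds+\frac{\lambda-\mu}{\xi}\bigl(1-e^{-\xi t}\bigr).$$ -/

import Mathlib

open MeasureTheory Set
open scoped NNReal Nat

noncomputable section

/-- The three-parameter Mittag-Leffler function
`E^δ_{β,γ}(w) = ∑_{r ≥ 0} w^r Γ(δ+r) / (r! Γ(βr+γ) Γ(δ))` at real arguments. -/
def mittagLeffler (δ β γ w : ℝ) : ℝ :=
  ∑' r : ℕ, w ^ r * Real.Gamma (δ + r) / (r ! * Real.Gamma (β * r + γ) * Real.Gamma δ)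

/-- Convolution in time: `(f ∗ g)(t) = ∫₀ᵗ f(s) g(t-s) ds`. -/
def timeConv (f g : ℝ → ℝ) (t : ℝ) : ℝ :=
  ∫ s in (0 : ℝ)..t, f s * g (t - s)

/-- The Riemann-Liouville fractional integral
`J^a f(t) = Γ(a)⁻¹ ∫₀ᵗ (t-s)^(a-1) f(s) ds` of order `a > 0`; `J^0` is the identity. -/
def rlIntegral (a : ℝ) (f : ℝ → ℝ) (t : ℝ) : ℝ :=
  if a = 0 then f t else (Real.Gamma a)⁻¹ * ∫ s in (0 : ℝ)..t, (t - s) ^ (a - 1) * f s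

/-- For `0 < α ≤ 1` and `f` continuous on `[0, ∞)`, the Caputo derivative of order `α` of `f` exists
at `t > 0` and equals `v`. It is the Riemann-Liouville derivative of `f - f(0)`, that is
`D^α f = d/dt J^(1-α) (f - f(0))`; when `f` is absolutely continuous, this is the function
`t ↦ Γ(1-α)⁻¹ ∫₀ᵗ (t-s)^(-α) f'(s) ds`, and for `α = 1` it is the ordinary derivative. -/
def HasCaputoDerivAt (α : ℝ) (f : ℝ → ℝ) (v t : ℝ) : Prop :=
  HasDerivAt (rlIntegral (1 - α) fun s => f s - f 0) v t

/-- `P_{i,n}(t) = P(X_t = n | X_0 = i)`, as a function of the real variable `t ≥ 0`. -/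
def transProb {Ω : Type*} [MeasurableSpace Ω] (P : Measure Ω) (X : ℝ≥0 → Ω → ℕ)
    (i n : ℕ) (t : ℝ) : ℝ :=
  (ProbabilityTheory.cond P (X 0 ⁻¹' {i})).real (X t.toNNReal ⁻¹' {n})

/-- The fractional `M/M/1` queue with catastrophes: a process `X` with values in `ℕ` whose
transition probabilities, from every state `i` in which it can start, are continuous in time and
satisfy the forward equations with the Caputo derivative of order `α` in time. The rates are `lam`
for arrivals, `μ` for services and `ξ` for catastrophes. -/
structure IsFractionalQueue {Ω : Type*} [MeasurableSpace Ω] (α lam μ ξ : ℝ)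
    (P : Measure Ω) (X : ℝ≥0 → Ω → ℕ) : Prop where
  measurable : ∀ t, Measurable (X t)
  continuousOn : ∀ i, P (X 0 ⁻¹' {i}) ≠ 0 → ∀ n, ContinuousOn (transProb P X i n) (Ici 0)
  caputo_zero : ∀ i, P (X 0 ⁻¹' {i}) ≠ 0 → ∀ t, 0 < t →
    HasCaputoDerivAt α (transProb P X i 0)
      (-(lam + ξ) * transProb P X i 0 t + μ * transProb P X i 1 t + ξ) t
  caputo_pos : ∀ i, P (X 0 ⁻¹' {i}) ≠ 0 → ∀ n, 0 < n → ∀ t, 0 < t →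
    HasCaputoDerivAt α (transProb P X i n)
      (-(lam + μ + ξ) * transProb P X i n t + lam * transProb P X i (n - 1) t
        + μ * transProb P X i (n + 1) t) t
  initial : ∀ i, P (X 0 ⁻¹' {i}) ≠ 0 → ∀ n, transProb P X i n 0 = if i = n then 1 else 0

end

/-! A Caputo equation with continuous data is equivalent, for this proof in one direction, to the
Volterra equation f = f(0) + J^α v (`eq_add_rlIntegral_of_hasCaputoDerivAt`). The proof works only
with this form, so no infinite sum is ever differentiated.

Write T_n = P(X_t > n). Finitely many forward equations combine into T_n = 1_{n<i} + J^α(-ξ T_n + λ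
p_n - μ p_{n+1}) (`tailProb_eq`): apart from catastrophes, only the flux between n and n+1 changes
T_n. Summing over n < K gives an equation for E[min(X_t, K)]. Discarding its nonpositive terms
bounds the truncated mean by i + λ t^α / Γ(α+1), uniformly in K (`sum_tailProb_le`), so the mean m
is finite. Dominated convergence as K → ∞ yields m = i + J^α(-ξ m + λ - μ + μ p_0) (`mean_eq`); the
term μ p_0 appears because an empty queue serves nobody.

For ξ = 0 this is already the formula. For ξ > 0 the equation is iterated by the semigroup law J^a
J^b = J^(a+b). The remainder (-ξ)^n J^(αn) m vanishes because Gamma outgrows geometric sequences,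
and the resulting series are Mittag-Leffler functions (`eq_mittagLeffler_of_volterra`). Uniqueness
for the infinite system of forward equations is never needed. -/

open Filter Topology

/-! ### Riemann-Liouville integrals as convolutions -/

/-- A function that is measurable on `[0, ∞)` and bounded on bounded subintervals. -/
structure LocallyBoundedMeasurable (f : ℝ → ℝ) : Prop where
  aestronglyMeasurable : AEStronglyMeasurable f (volume.restrict (Ici 0))
  bounded : ∀ T, ∃ C, ∀ s ∈ Icc 0 T, |f s| ≤ C

/-- The convolution kernel of the Riemann-Liouville integral of order `a`. -/
noncomputable def fracKernel (a : ℝ) : ℝ → ℝ :=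
  (Ioi (0 : ℝ)).indicator fun s => (Real.Gamma a)⁻¹ * s ^ (a - 1)

theorem measurable_fracKernel (a : ℝ) : Measurable (fracKernel a) := by
  unfold fracKernel
  exact Measurable.indicator (by fun_prop) measurableSet_Ioi

theorem fracKernel_nonneg {a : ℝ} (ha : 0 < a) (s : ℝ) : 0 ≤ fracKernel a s := by
  unfold fracKernel
  refine indicator_nonneg (fun s hs => ?_) s
  have := Real.Gamma_pos_of_pos ha
  have := Real.rpow_nonneg (le_of_lt (mem_Ioi.1 hs)) (a - 1)
  positivity

theorem integral_rpow_mul_sub_rpow {a b x : ℝ} (ha : 0 < a) (hb : 0 < b) (hx : 0 < x) :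
    ∫ s in (0 : ℝ)..x, s ^ (a - 1) * (x - s) ^ (b - 1) =
      x ^ (a + b - 1) * (Real.Gamma a * Real.Gamma b / Real.Gamma (a + b)) := by
  have h := Complex.betaIntegral_scaled a b hx
  rw [Complex.betaIntegral_eq_Gamma_mul_div _ _ (by simpa) (by simpa)] at h
  have h2 : ∫ s in (0 : ℝ)..x, (s : ℂ) ^ ((a : ℂ) - 1) * ((x : ℂ) - s) ^ ((b : ℂ) - 1) =
      ∫ s in (0 : ℝ)..x, ((s ^ (a - 1) * (x - s) ^ (b - 1) : ℝ) : ℂ) := by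
    refine intervalIntegral.integral_congr fun s hs => ?_
    rw [uIcc_of_le hx.le] at hs
    simp only [Complex.ofReal_mul]
    rw [Complex.ofReal_cpow hs.1, Complex.ofReal_cpow (sub_nonneg.2 hs.2)]
    push_cast
    rfl
  rw [h2, intervalIntegral.integral_ofReal, ← Complex.ofReal_add, Complex.Gamma_ofReal,
    Complex.Gamma_ofReal, Complex.Gamma_ofReal, ← Complex.ofReal_one, ← Complex.ofReal_sub,
    ← Complex.ofReal_cpow hx.le] at h
  exact_mod_cast h

theorem fracKernel_mul_fracKernel_sub (a b x : ℝ) :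
    (fun s => fracKernel a s * fracKernel b (x - s)) =
      (Ioo 0 x).indicator fun s => ((Real.Gamma a)⁻¹ * (Real.Gamma b)⁻¹) *
        (s ^ (a - 1) * (x - s) ^ (b - 1)) := by
  ext s
  by_cases h0 : 0 < s <;> by_cases h1 : s < x <;> simp [fracKernel, indicator, h0, h1]
  ring

theorem integral_fracKernel_mul_fracKernel_sub {a b : ℝ} (ha : 0 < a) (hb : 0 < b) (x : ℝ) :
    ∫ s, fracKernel a s * fracKernel b (x - s) = fracKernel (a + b) x := by
  rw [fracKernel_mul_fracKernel_sub, integral_indicator measurableSet_Ioo]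
  rcases le_or_gt x 0 with hx | hx
  · simp [fracKernel, hx]
  · rw [← integral_Ioc_eq_integral_Ioo, ← intervalIntegral.integral_of_le hx.le,
      intervalIntegral.integral_const_mul, integral_rpow_mul_sub_rpow ha hb hx]
    have h1 := (Real.Gamma_pos_of_pos ha).ne'
    have h2 := (Real.Gamma_pos_of_pos hb).ne'
    have h3 := (Real.Gamma_pos_of_pos (add_pos ha hb)).ne'
    simp only [fracKernel, mem_Ioi, hx, indicator_of_mem]
    field_simp

/-- For x > 0 the Bochner integral has already been computed and is nonzero; a non-integrable
function would have integral 0 by convention. -/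
theorem integrable_fracKernel_mul_fracKernel_sub {a b : ℝ} (ha : 0 < a) (hb : 0 < b) (x : ℝ) :
    Integrable fun s => fracKernel a s * fracKernel b (x - s) := by
  rcases le_or_gt x 0 with hx | hx
  · simp [fracKernel_mul_fracKernel_sub, Ioo_eq_empty_of_le hx]
  · by_contra h
    have h1 := integral_undef h
    rw [integral_fracKernel_mul_fracKernel_sub ha hb] at h1
    simp only [fracKernel, mem_Ioi, hx, indicator_of_mem] at h1
    have h2 := Real.Gamma_pos_of_pos (add_pos ha hb)
    have h3 := Real.rpow_pos_of_pos hx (a + b - 1)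
    exact absurd h1 (by positivity)

theorem fracKernel_one : fracKernel 1 = (Ioi 0).indicator fun _ => 1 := by
  simp [fracKernel]

/-- On `[0, ∞)` the Riemann-Liouville integral is the convolution with `fracKernel`. -/
theorem rlIntegral_eq_integral {a : ℝ} (ha : 0 < a) (f : ℝ → ℝ) {t : ℝ} (ht : 0 ≤ t) :
    rlIntegral a f t = ∫ s, (Ici 0).indicator f s * fracKernel a (t - s) := by
  have : (fun s => (Ici 0).indicator f s * fracKernel a (t - s)) =
      (Ico 0 t).indicator fun s => (Real.Gamma a)⁻¹ * ((t - s) ^ (a - 1) * f s) := by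
    ext s
    by_cases h0 : 0 ≤ s <;> by_cases h1 : s < t <;> simp [fracKernel, indicator, h0, h1]
    ring
  rw [this, integral_indicator measurableSet_Ico, integral_Ico_eq_integral_Ioo,
    ← integral_Ioc_eq_integral_Ioo, ← intervalIntegral.integral_of_le ht,
    intervalIntegral.integral_const_mul, rlIntegral, if_neg ha.ne']

theorem ae_norm_indicator_mul_fracKernel_le {a : ℝ} (ha : 0 < a) {f : ℝ → ℝ} {C t : ℝ}
    (hC : ∀ s ∈ Icc 0 t, |f s| ≤ C) :
    ∀ᵐ s, ‖(Ici 0).indicator f s * fracKernel a (t - s)‖ ≤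
      C * (fracKernel 1 s * fracKernel a (t - s)) := by
  -- The point 0 is removed because the indicator of `Ici 0` is 1 there while `fracKernel 1` is 0.
  filter_upwards [compl_mem_ae_iff.2 (measure_singleton (0 : ℝ))] with s hs
  rw [norm_mul, Real.norm_of_nonneg (fracKernel_nonneg ha _), ← mul_assoc]
  by_cases h1 : t ≤ s
  · simp [fracKernel, h1]
  refine mul_le_mul_of_nonneg_right ?_ (fracKernel_nonneg ha _)
  rw [fracKernel_one]
  rcases lt_trichotomy s 0 with h | h | h
  · simp [h.not_ge, h.le]
  · exact absurd h hs
  · simpa [h, h.le] using hC s ⟨h.le, (not_le.1 h1).le⟩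

theorem abs_rlIntegral_le {a : ℝ} (ha : 0 < a) {f : ℝ → ℝ} {C t : ℝ} (ht : 0 ≤ t)
    (hC : ∀ s ∈ Icc 0 t, |f s| ≤ C) : |rlIntegral a f t| ≤ C * (t ^ a / Real.Gamma (a + 1)) := by
  have hk : fracKernel (1 + a) t ≤ t ^ a / Real.Gamma (a + 1) := by
    rcases ht.eq_or_lt with rfl | h
    · have := Real.Gamma_pos_of_pos (add_pos ha one_pos)
      simp [fracKernel]; positivity
    · simp [fracKernel, h, add_comm, div_eq_inv_mul]
  have hC0 : 0 ≤ C := (abs_nonneg _).trans (hC 0 ⟨le_rfl, ht⟩)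
  refine le_trans ?_ (mul_le_mul_of_nonneg_left hk hC0)
  rw [rlIntegral_eq_integral ha f ht, ← integral_fracKernel_mul_fracKernel_sub one_pos ha,
    ← integral_const_mul]
  refine norm_integral_le_of_norm_le
    ((integrable_fracKernel_mul_fracKernel_sub one_pos ha t).const_mul C)
    (ae_norm_indicator_mul_fracKernel_le ha hC)

namespace LocallyBoundedMeasurable

variable {f g : ℝ → ℝ}

theorem of_continuousOn (hf : ContinuousOn f (Ici 0)) : LocallyBoundedMeasurable f where
  aestronglyMeasurable := hf.aestronglyMeasurable measurableSet_Ici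
  bounded T := by
    obtain ⟨C, hC⟩ := isCompact_Icc.exists_bound_of_continuousOn
      (hf.mono (Icc_subset_Ici_self : Icc 0 T ⊆ Ici 0))
    exact ⟨C, hC⟩

theorem const (c : ℝ) : LocallyBoundedMeasurable fun _ => c :=
  of_continuousOn continuousOn_const

theorem add (hf : LocallyBoundedMeasurable f) (hg : LocallyBoundedMeasurable g) :
    LocallyBoundedMeasurable fun s => f s + g s where
  aestronglyMeasurable := hf.1.add hg.1
  bounded T := by
    obtain ⟨C, hC⟩ := hf.2 T
    obtain ⟨D, hD⟩ := hg.2 T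
    exact ⟨C + D, fun s hs => (abs_add_le _ _).trans (add_le_add (hC s hs) (hD s hs))⟩

theorem const_mul (c : ℝ) (hf : LocallyBoundedMeasurable f) :
    LocallyBoundedMeasurable fun s => c * f s where
  aestronglyMeasurable := hf.1.const_mul c
  bounded T := by
    obtain ⟨C, hC⟩ := hf.2 T
    exact ⟨|c| * C, fun s hs => by
      rw [abs_mul]; exact mul_le_mul_of_nonneg_left (hC s hs) (abs_nonneg _)⟩

theorem aestronglyMeasurable_indicator (hf : LocallyBoundedMeasurable f) :
    AEStronglyMeasurable ((Ici 0).indicator f) :=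
  (aestronglyMeasurable_indicator_iff measurableSet_Ici).2 hf.1

theorem integrable_mul_fracKernel {a : ℝ} (ha : 0 < a) (hf : LocallyBoundedMeasurable f) (t : ℝ) :
    Integrable fun s => (Ici 0).indicator f s * fracKernel a (t - s) := by
  obtain ⟨C, hC⟩ := hf.2 t
  refine ((integrable_fracKernel_mul_fracKernel_sub one_pos ha t).const_mul C).mono'
    (hf.aestronglyMeasurable_indicator.mul
      ((measurable_fracKernel a).comp (measurable_const.sub measurable_id)).aestronglyMeasurable)
    (ae_norm_indicator_mul_fracKernel_le ha hC)

theorem rlIntegral {a : ℝ} (ha : 0 < a) (hf : LocallyBoundedMeasurable f) :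
    LocallyBoundedMeasurable (rlIntegral a f) where
  aestronglyMeasurable := by
    have := (hf.aestronglyMeasurable_indicator.convolution_integrand (μ := volume) (ν := volume)
      (ContinuousLinearMap.mul ℝ ℝ)
      (measurable_fracKernel a).aestronglyMeasurable).integral_prod_right'
    refine (this.mono_measure Measure.restrict_le_self).congr ?_
    filter_upwards [ae_restrict_mem measurableSet_Ici] with t ht
    rw [rlIntegral_eq_integral ha f ht]
    simp
  bounded T := by
    obtain ⟨C, hC⟩ := hf.2 T
    refine ⟨|C| * (T ^ a / Real.Gamma (a + 1)), fun s hs => (abs_rlIntegral_le ha hs.1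
      (C := |C|) fun u hu => (hC u ⟨hu.1, hu.2.trans hs.2⟩).trans (le_abs_self C)).trans ?_⟩
    have := Real.Gamma_pos_of_pos (add_pos ha one_pos)
    have := Real.rpow_le_rpow hs.1 hs.2 ha.le
    gcongr

theorem rlIntegral_add {a : ℝ} (ha : 0 < a) (hf : LocallyBoundedMeasurable f)
    (hg : LocallyBoundedMeasurable g) {t : ℝ} (ht : 0 ≤ t) :
    _root_.rlIntegral a (fun s => f s + g s) t =
      _root_.rlIntegral a f t + _root_.rlIntegral a g t := by
  rw [rlIntegral_eq_integral ha _ ht, rlIntegral_eq_integral ha _ ht,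
    rlIntegral_eq_integral ha _ ht, ← integral_add (hf.integrable_mul_fracKernel ha t)
      (hg.integrable_mul_fracKernel ha t)]
  congr with s
  rw [indicator_add, add_mul]

end LocallyBoundedMeasurable

theorem rlIntegral_const_mul (a c : ℝ) (f : ℝ → ℝ) (t : ℝ) :
    rlIntegral a (fun s => c * f s) t = c * rlIntegral a f t := by
  unfold rlIntegral
  split_ifs
  · rfl
  · simp_rw [mul_left_comm _ c, intervalIntegral.integral_const_mul]
    ring

theorem rlIntegral_congr {a : ℝ} (ha : 0 < a) {f g : ℝ → ℝ} {t : ℝ} (ht : 0 ≤ t)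
    (h : ∀ s ∈ Icc 0 t, f s = g s) : rlIntegral a f t = rlIntegral a g t := by
  rw [rlIntegral, rlIntegral, if_neg ha.ne', if_neg ha.ne']
  congr 1
  refine intervalIntegral.integral_congr fun s hs => ?_
  rw [uIcc_of_le ht] at hs
  simp only [h s hs]

theorem rlIntegral_one_apply (f : ℝ → ℝ) (t : ℝ) :
    rlIntegral 1 f t = ∫ s in (0 : ℝ)..t, f s := by
  simp [rlIntegral]

/-- The semigroup property of the Riemann-Liouville integrals. -/
theorem rlIntegral_rlIntegral {a b : ℝ} (ha : 0 < a) (hb : 0 < b) {f : ℝ → ℝ}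
    (hf : LocallyBoundedMeasurable f) {t : ℝ} (ht : 0 ≤ t) :
    rlIntegral a (rlIntegral b f) t = rlIntegral (b + a) f t := by
  have key := convolution_assoc (μ := volume) (ν := volume) (ContinuousLinearMap.mul ℝ ℝ)
    (ContinuousLinearMap.mul ℝ ℝ) (ContinuousLinearMap.mul ℝ ℝ) (ContinuousLinearMap.mul ℝ ℝ)
    (fun x y z => mul_assoc x y z) (f := (Ici 0).indicator f) (g := fracKernel b)
    (k := fracKernel a) (x₀ := t) hf.aestronglyMeasurable_indicator
    (measurable_fracKernel b).aestronglyMeasurable (measurable_fracKernel a).aestronglyMeasurable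
    (Eventually.of_forall fun x => hf.integrable_mul_fracKernel hb x)
    (Eventually.of_forall fun x => by
      simp_rw [Real.norm_of_nonneg (fracKernel_nonneg ha _),
        Real.norm_of_nonneg (fracKernel_nonneg hb _)]
      exact integrable_fracKernel_mul_fracKernel_sub hb ha x)
    (by
      have h1 := (hf.integrable_mul_fracKernel (add_pos hb ha) t).norm
      refine h1.congr (Eventually.of_forall fun s => ?_)
      simp only [convolution, ContinuousLinearMap.mul_apply', norm_mul,
        Real.norm_of_nonneg (fracKernel_nonneg ha _), Real.norm_of_nonneg (fracKernel_nonneg hb _),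
        Real.norm_of_nonneg (fracKernel_nonneg (add_pos hb ha) _),
        integral_fracKernel_mul_fracKernel_sub hb ha])
  simp only [convolution, ContinuousLinearMap.mul_apply',
    integral_fracKernel_mul_fracKernel_sub hb ha] at key
  rw [rlIntegral_eq_integral (add_pos hb ha) f ht, ← key, rlIntegral_eq_integral ha _ ht]
  congr with s
  by_cases hs : 0 ≤ s
  · rw [indicator_of_mem (mem_Ici.2 hs), rlIntegral_eq_integral hb f hs]
  -- For s < 0 the inner convolution vanishes too: the two factors have disjoint supports.
  · rw [indicator_of_notMem (by simpa using hs), zero_mul]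
    rw [integral_eq_zero_of_ae, zero_mul]
    refine Eventually.of_forall fun u => ?_
    by_cases hu : 0 ≤ u
    · simp [fracKernel, show s ≤ u by linarith]
    · simp [hu]

theorem rlIntegral_rpow {a b : ℝ} (ha : 0 < a) (hb : 0 ≤ b) {t : ℝ} (ht : 0 ≤ t) :
    rlIntegral a (fun s => s ^ b) t =
      Real.Gamma (b + 1) * t ^ (b + a) / Real.Gamma (b + a + 1) := by
  rw [rlIntegral, if_neg ha.ne']
  rcases ht.eq_or_lt with rfl | ht
  · simp [Real.zero_rpow (show b + a ≠ 0 by positivity)]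
  · have := integral_rpow_mul_sub_rpow (add_pos_of_nonneg_of_pos hb one_pos) ha ht
    simp only [add_sub_cancel_right] at this
    simp_rw [mul_comm _ (_ ^ b), this]
    have := (Real.Gamma_pos_of_pos ha).ne'
    rw [show b + 1 + a - 1 = b + a by ring, show b + 1 + a = b + a + 1 by ring]
    field_simp

theorem rlIntegral_const {a : ℝ} (ha : 0 < a) (c : ℝ) {t : ℝ} (ht : 0 ≤ t) :
    rlIntegral a (fun _ => c) t = c * t ^ a / Real.Gamma (a + 1) := by
  have h := rlIntegral_const_mul a c (fun s => s ^ (0 : ℝ)) t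
  rw [rlIntegral_rpow ha le_rfl ht] at h
  simpa [mul_div_assoc] using h

theorem rlIntegral_zero (f : ℝ → ℝ) : rlIntegral 0 f = f := by
  ext t
  simp [rlIntegral]

theorem rlIntegral_apply_zero {a : ℝ} (ha : 0 < a) (f : ℝ → ℝ) : rlIntegral a f 0 = 0 := by
  simp [rlIntegral, ha.ne']

/-- The substitution s = t x moves t out of both the domain and the singular kernel, which makes
dominated convergence in t available. -/
theorem rlIntegral_eq_rpow_mul {a : ℝ} (ha : 0 < a) (f : ℝ → ℝ) {t : ℝ} (ht : 0 ≤ t) :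
    rlIntegral a f t =
      (Real.Gamma a)⁻¹ * t ^ a * ∫ x in (0 : ℝ)..1, (1 - x) ^ (a - 1) * f (t * x) := by
  rcases ht.eq_or_lt with rfl | ht
  · simp [rlIntegral, ha.ne']
  have h := intervalIntegral.smul_integral_comp_mul_left (a := 0) (b := 1)
    (fun s => (t - s) ^ (a - 1) * f s) t
  rw [mul_zero, mul_one] at h
  rw [rlIntegral, if_neg ha.ne', ← h, mul_assoc]
  congr 1
  have h2 : ∀ x ∈ uIcc (0 : ℝ) 1, (t - t * x) ^ (a - 1) * f (t * x) =
      t ^ (a - 1) * ((1 - x) ^ (a - 1) * f (t * x)) := by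
    intro x hx
    rw [uIcc_of_le zero_le_one] at hx
    rw [← mul_one_sub, Real.mul_rpow ht.le (sub_nonneg.2 hx.2), mul_assoc]
  rw [intervalIntegral.integral_congr h2, intervalIntegral.integral_const_mul, smul_eq_mul,
    ← mul_assoc]
  congr 1
  rw [← Real.rpow_one_add' ht.le (by simpa using ha.ne'), add_sub_cancel]

theorem intervalIntegrable_sub_rpow {a : ℝ} (ha : 0 < a) (t : ℝ) :
    IntervalIntegrable (fun s => (t - s) ^ (a - 1)) volume 0 t := by
  have := ((intervalIntegral.intervalIntegrable_rpow' (a := 0) (b := t)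
    (by linarith : -1 < a - 1)).comp_sub_left t).symm
  simpa using this

theorem continuousOn_rlIntegral {a : ℝ} (ha : 0 ≤ a) {f : ℝ → ℝ} (hf : ContinuousOn f (Ici 0)) :
    ContinuousOn (rlIntegral a f) (Ici 0) := by
  rcases ha.eq_or_lt with rfl | ha
  · rwa [rlIntegral_zero]
  -- A globally continuous extension of f avoids one-sided limits at 0.
  have hg : Continuous fun s => f (max s 0) :=
    hf.comp_continuous (by fun_prop) fun s => le_max_right s 0
  have hc : Continuous fun t => ∫ x in (0 : ℝ)..1, (1 - x) ^ (a - 1) * f (max (t * x) 0) := by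
    refine continuous_iff_continuousAt.2 fun t₀ => ?_
    obtain ⟨C, hC⟩ := (isCompact_Icc (a := -(|t₀| + 1)) (b := |t₀| + 1)).exists_bound_of_continuousOn
      hg.continuousOn
    refine intervalIntegral.continuousAt_of_dominated_interval
      (bound := fun x => (1 - x) ^ (a - 1) * C) (Eventually.of_forall fun t => ?_) ?_
      ((intervalIntegrable_sub_rpow ha 1).mul_const C) ?_
    · exact (Measurable.aestronglyMeasurable (by fun_prop)).mul
        (hg.comp (continuous_const.mul continuous_id)).aestronglyMeasurable
    · have : ∀ᶠ t in 𝓝 t₀, |t| < |t₀| + 1 := continuous_abs.continuousAt.eventually_lt_const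
        (lt_add_one _)
      filter_upwards [this] with t ht
      refine Eventually.of_forall fun x hx => ?_
      rw [uIoc_of_le zero_le_one] at hx
      have h0 := Real.rpow_nonneg (sub_nonneg.2 hx.2) (a - 1)
      rw [norm_mul, Real.norm_of_nonneg h0]
      refine mul_le_mul_of_nonneg_left (hC _ (abs_le.1 ?_)) h0
      rw [abs_mul, abs_of_pos hx.1]
      exact (mul_le_of_le_one_right (abs_nonneg t) hx.2).trans ht.le
    · exact Eventually.of_forall fun x _ =>
        (continuous_const.mul (hg.comp (continuous_id.mul continuous_const))).continuousAt
  have hc2 : Continuous fun t : ℝ => (Real.Gamma a)⁻¹ * t ^ a :=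
    continuous_const.mul (Real.continuous_rpow_const ha.le)
  refine (hc2.mul hc).continuousOn.congr fun t ht => ?_
  rw [rlIntegral_eq_rpow_mul ha f ht]
  congr 1
  refine intervalIntegral.integral_congr fun x hx => ?_
  rw [uIcc_of_le zero_le_one] at hx
  simp only [max_eq_left (mul_nonneg ht hx.1)]

/-! ### From Caputo equations to Volterra equations -/

theorem eqOn_of_rlIntegral_one_eq {f g : ℝ → ℝ} (hf : ContinuousOn f (Ici 0))
    (hg : ContinuousOn g (Ici 0)) (h : ∀ t, 0 ≤ t → rlIntegral 1 f t = rlIntegral 1 g t)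
    {t : ℝ} (ht : 0 < t) : f t = g t := by
  have key : ∀ {k : ℝ → ℝ}, ContinuousOn k (Ici 0) → HasDerivAt (rlIntegral 1 k) (k t) t := by
    intro k hk
    have hkt : ContinuousOn k (Ioi 0) := hk.mono Ioi_subset_Ici_self
    have : rlIntegral 1 k = fun t => ∫ s in (0 : ℝ)..t, k s := funext (rlIntegral_one_apply k)
    rw [this]
    refine intervalIntegral.integral_hasDerivAt_right
      (ContinuousOn.intervalIntegrable (hk.mono ?_))
      (hkt.stronglyMeasurableAtFilter isOpen_Ioi t ht) (hkt.continuousAt (Ioi_mem_nhds ht))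
    rw [uIcc_of_le ht.le]
    exact Icc_subset_Ici_self
  refine (key hf).unique ((key hg).congr_of_eventuallyEq ?_)
  filter_upwards [Ioi_mem_nhds ht] with s hs using h s (le_of_lt hs)

/-- A Caputo differential equation with continuous data implies its Volterra integral form. -/
theorem eq_add_rlIntegral_of_hasCaputoDerivAt {α : ℝ} (hα0 : 0 < α) (hα1 : α ≤ 1) {f v : ℝ → ℝ}
    (hf : ContinuousOn f (Ici 0)) (hv : ContinuousOn v (Ici 0))
    (h : ∀ t, 0 < t → HasCaputoDerivAt α f (v t) t) {t : ℝ} (ht : 0 ≤ t) :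
    f t = f 0 + rlIntegral α v t := by
  have hg : ContinuousOn (fun s => f s - f 0) (Ici 0) := hf.sub continuousOn_const
  have hGc := continuousOn_rlIntegral (sub_nonneg.2 hα1) hg
  have hG0 : rlIntegral (1 - α) (fun s => f s - f 0) 0 = 0 := by
    simp [rlIntegral]
  have hG : ∀ t, 0 ≤ t → rlIntegral (1 - α) (fun s => f s - f 0) t = rlIntegral 1 v t := by
    intro t ht
    have := intervalIntegral.integral_eq_sub_of_hasDerivAt_of_le ht
      (hGc.mono Icc_subset_Ici_self) (fun x hx => h x hx.1)
      (ContinuousOn.intervalIntegrable (hv.mono (by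
        rw [uIcc_of_le ht]; exact Icc_subset_Ici_self)))
    rw [hG0, sub_zero] at this
    rw [rlIntegral_one_apply, this]
  -- α = 1 is treated apart: J^0 is the identity by definition, and the semigroup law is stated for
  -- positive orders.
  rcases hα1.eq_or_lt with rfl | hα1
  · have := hG t ht
    rw [sub_self, rlIntegral_zero] at this
    linarith
  rcases ht.eq_or_lt with rfl | ht
  · rw [rlIntegral_apply_zero hα0, add_zero]
  have hgL := LocallyBoundedMeasurable.of_continuousOn hg
  have hvL := LocallyBoundedMeasurable.of_continuousOn hv
  -- Applying J^α to J^(1-α) g = J^1 v gives J^1 g = J^1 (J^α v); both integrands are continuous, so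
  -- J^1 can be cancelled.
  have := eqOn_of_rlIntegral_one_eq hg (continuousOn_rlIntegral hα0.le hv) (fun t ht => by
    have h1 := rlIntegral_rlIntegral hα0 (sub_pos.2 hα1) hgL ht
    rw [rlIntegral_congr hα0 ht (fun s hs => hG s hs.1),
      rlIntegral_rlIntegral hα0 one_pos hvL ht, sub_add_cancel] at h1
    rw [← h1, rlIntegral_rlIntegral one_pos hα0 hvL ht, add_comm]) ht
  linarith

/-! ### Monotonicity and limits under the fractional integral -/

theorem rlIntegral_mono {a : ℝ} (ha : 0 < a) {f g : ℝ → ℝ} (hf : LocallyBoundedMeasurable f)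
    (hg : LocallyBoundedMeasurable g) {t : ℝ} (ht : 0 ≤ t) (h : ∀ s, 0 ≤ s → f s ≤ g s) :
    rlIntegral a f t ≤ rlIntegral a g t := by
  rw [rlIntegral_eq_integral ha f ht, rlIntegral_eq_integral ha g ht]
  refine integral_mono (hf.integrable_mul_fracKernel ha t) (hg.integrable_mul_fracKernel ha t)
    fun s => mul_le_mul_of_nonneg_right ?_ (fracKernel_nonneg ha _)
  exact indicator_le_indicator' fun hs => h s hs

theorem tendsto_rlIntegral {a : ℝ} (ha : 0 < a) {f : ℕ → ℝ → ℝ} {g : ℝ → ℝ}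
    (hf : ∀ n, LocallyBoundedMeasurable (f n)) {C t : ℝ} (ht : 0 ≤ t)
    (hC : ∀ n, ∀ s ∈ Icc 0 t, |f n s| ≤ C)
    (h : ∀ s, 0 ≤ s → Tendsto (fun n => f n s) atTop (𝓝 (g s))) :
    Tendsto (fun n => rlIntegral a (f n) t) atTop (𝓝 (rlIntegral a g t)) := by
  simp_rw [rlIntegral_eq_integral ha _ ht]
  refine tendsto_integral_of_dominated_convergence _
    (fun n => ((hf n).integrable_mul_fracKernel ha t).1)
    ((integrable_fracKernel_mul_fracKernel_sub one_pos ha t).const_mul C)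
    (fun n => ae_norm_indicator_mul_fracKernel_le ha (hC n)) (Eventually.of_forall fun s => ?_)
  refine Tendsto.mul_const _ ?_
  by_cases hs : 0 ≤ s
  · simpa [hs] using h s hs
  · simp [hs]

theorem LocallyBoundedMeasurable.of_tendsto {f : ℕ → ℝ → ℝ} {g : ℝ → ℝ}
    (hf : ∀ n, LocallyBoundedMeasurable (f n)) (hC : ∀ T, ∃ C, ∀ n, ∀ s ∈ Icc 0 T, |f n s| ≤ C)
    (h : ∀ s, 0 ≤ s → Tendsto (fun n => f n s) atTop (𝓝 (g s))) :
    LocallyBoundedMeasurable g where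
  aestronglyMeasurable := by
    refine aestronglyMeasurable_of_tendsto_ae atTop (fun n => (hf n).1) ?_
    filter_upwards [ae_restrict_mem measurableSet_Ici] with s hs using h s hs
  bounded T := by
    obtain ⟨C, hC⟩ := hC T
    exact ⟨C, fun s hs => le_of_tendsto (h s hs.1).abs (Eventually.of_forall fun n => hC n s hs)⟩

/-! ### Gamma growth and Mittag-Leffler series -/

/-- Log-convexity of Gamma, since x = a (x+a-1) + (1-a) (x+a). The bound makes Γ(x)/Γ(x+a) tend to
0, as the ratio test below requires. -/
theorem rpow_mul_Gamma_le_Gamma_add {a x : ℝ} (ha0 : 0 < a) (ha1 : a ≤ 1) (hx : 1 < x) :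
    (x + a - 1) ^ a * Real.Gamma x ≤ Real.Gamma (x + a) := by
  have hs : 0 < x + a - 1 := by linarith
  have hG : Real.Gamma (x + a) = (x + a - 1) * Real.Gamma (x + a - 1) := by
    rw [← Real.Gamma_add_one hs.ne', sub_add_cancel]
  rcases ha1.eq_or_lt with rfl | ha1
  · simp [hG]
  have ht : 0 < x + a := by linarith
  have h := Real.Gamma_mul_add_mul_le_rpow_Gamma_mul_rpow_Gamma hs ht ha0 (sub_pos.2 ha1)
    (add_sub_cancel _ _)
  rw [show a * (x + a - 1) + (1 - a) * (x + a) = x by ring] at h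
  refine (mul_le_mul_of_nonneg_left h (Real.rpow_nonneg hs.le a)).trans_eq ?_
  rw [← mul_assoc, ← Real.mul_rpow hs.le (Real.Gamma_pos_of_pos hs).le, ← hG,
    ← Real.rpow_add (Real.Gamma_pos_of_pos ht), add_sub_cancel, Real.rpow_one]

theorem summable_pow_div_Gamma {α γ : ℝ} (hα0 : 0 < α) (hα1 : α ≤ 1) (hγ : 0 < γ) (w : ℝ) :
    Summable fun r : ℕ => w ^ r / Real.Gamma (α * r + γ) := by
  refine summable_of_ratio_norm_eventually_le (r := 1 / 2) (by norm_num) ?_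
  have hlim : Tendsto (fun r : ℕ => α * r + γ) atTop atTop :=
    tendsto_atTop_add_const_right _ _ (tendsto_natCast_atTop_atTop.const_mul_atTop hα0)
  have hlim2 : Tendsto (fun r : ℕ => (α * r + γ + α - 1) ^ α) atTop atTop :=
    (tendsto_rpow_atTop hα0).comp (tendsto_atTop_add_const_right _ (-1)
      (tendsto_atTop_add_const_right _ _ hlim))
  filter_upwards [hlim.eventually_gt_atTop 1, hlim2.eventually_ge_atTop (2 * |w|)] with r h1 h2
  have h3 := rpow_mul_Gamma_le_Gamma_add hα0 hα1 h1
  have hx := Real.Gamma_pos_of_pos (one_pos.trans h1)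
  have hy : 0 < Real.Gamma (α * r + γ + α) := Real.Gamma_pos_of_pos (by linarith)
  rw [norm_div, norm_div, norm_pow, norm_pow, Real.norm_eq_abs w, Real.norm_of_nonneg hx.le,
    show α * ((r + 1 : ℕ) : ℝ) + γ = α * r + γ + α by push_cast; ring, Real.norm_of_nonneg hy.le,
    pow_succ, div_le_iff₀ hy]
  have h4 := (mul_le_mul_of_nonneg_right h2 hx.le).trans h3
  have h5 : 0 ≤ |w| ^ r / (2 * Real.Gamma (α * r + γ)) := by positivity
  have h6 := mul_le_mul_of_nonneg_left h4 h5
  refine le_trans (le_of_eq ?_) (h6.trans (le_of_eq ?_))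
  · field_simp
  · field_simp

theorem mittagLeffler_one (α γ w : ℝ) :
    mittagLeffler 1 α γ w = ∑' r : ℕ, w ^ r / Real.Gamma (α * r + γ) := by
  unfold mittagLeffler
  congr with r
  have hr : (r ! : ℝ) ≠ 0 := by positivity
  rw [add_comm, Real.Gamma_nat_eq_factorial, Real.Gamma_one, mul_one, mul_comm (w ^ r),
    mul_div_mul_left _ _ hr]

/-- Weierstrass M-test near w, dominated by the series at |w| + 1. -/
theorem continuous_mittagLeffler_one {α γ : ℝ} (hα0 : 0 < α) (hα1 : α ≤ 1) (hγ : 0 < γ) :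
    Continuous (mittagLeffler 1 α γ) := by
  refine continuous_iff_continuousAt.2 fun w => ?_
  have hc : ContinuousOn (mittagLeffler 1 α γ) (Icc (w - 1) (w + 1)) := by
    rw [funext (mittagLeffler_one α γ)]
    refine continuousOn_tsum (fun r => by fun_prop)
      (summable_pow_div_Gamma hα0 hα1 hγ (|w| + 1)) fun r x hx => ?_
    have hG : 0 < Real.Gamma (α * r + γ) := Real.Gamma_pos_of_pos (by positivity)
    rw [norm_div, norm_pow, Real.norm_of_nonneg hG.le]
    gcongr
    refine abs_le.2 ⟨?_, ?_⟩
    · linarith [hx.1, neg_abs_le w]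
    · linarith [hx.2, le_abs_self w]
  exact hc.continuousAt (Icc_mem_nhds (by linarith) (by linarith))

theorem mittagLeffler_one_one_one (w : ℝ) : mittagLeffler 1 1 1 w = Real.exp w := by
  rw [mittagLeffler_one, Real.exp_eq_exp_ℝ, NormedSpace.exp_eq_tsum_div]
  congr with r
  rw [one_mul, Real.Gamma_nat_eq_factorial]

theorem neg_mul_rpow_pow {t : ℝ} (ht : 0 ≤ t) (ξ α : ℝ) (r : ℕ) :
    (-ξ * t ^ α) ^ r = (-ξ) ^ r * t ^ (α * r) := by
  rw [mul_pow, Real.rpow_mul_natCast ht]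

theorem hasSum_mittagLeffler_one {α γ : ℝ} (hα0 : 0 < α) (hα1 : α ≤ 1) (hγ : 0 < γ) (w : ℝ) :
    HasSum (fun r : ℕ => w ^ r / Real.Gamma (α * r + γ)) (mittagLeffler 1 α γ w) := by
  rw [mittagLeffler_one]
  exact (summable_pow_div_Gamma hα0 hα1 hγ w).hasSum

/-! ### Resolvent of the fractional Volterra equation -/

theorem intervalIntegrable_mul_mittagLeffler {α : ℝ} (hα0 : 0 < α) (hα1 : α ≤ 1) (ξ : ℝ)
    {h : ℝ → ℝ} (hh : ContinuousOn h (Ici 0)) {t : ℝ} (ht : 0 ≤ t) :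
    IntervalIntegrable (fun s => h s *
      ((t - s) ^ (α - 1) * mittagLeffler 1 α α (-ξ * (t - s) ^ α))) volume 0 t := by
  have h1 : ContinuousOn (fun s => h s * mittagLeffler 1 α α (-ξ * (t - s) ^ α)) (uIcc 0 t) := by
    refine ContinuousOn.mul (hh.mono (by rw [uIcc_of_le ht]; exact Icc_subset_Ici_self)) ?_
    refine Continuous.continuousOn ((continuous_mittagLeffler_one hα0 hα1 hα0).comp ?_)
    exact continuous_const.mul
      ((Real.continuous_rpow_const hα0.le).comp (continuous_const.sub continuous_id))
  refine ((intervalIntegrable_sub_rpow hα0 t).mul_continuousOn h1).congr ?_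
  exact fun s _ => by ring

/-- For s > 0 the Mittag-Leffler kernel is the sum of (-ξ)^k `fracKernel (α * k + α)` s. Termwise
integration is allowed because the L¹ norms are dominated by the series C t^α ∑ (|ξ| t^α)^k /
Γ(αk+α+1). -/
theorem hasSum_pow_mul_rlIntegral {α : ℝ} (hα0 : 0 < α) (hα1 : α ≤ 1) (ξ : ℝ)
    {h : ℝ → ℝ} (hh : LocallyBoundedMeasurable h) {t : ℝ} (ht : 0 ≤ t) :
    HasSum (fun k : ℕ => (-ξ) ^ k * rlIntegral (α * k + α) h t)
      (timeConv h (fun s => s ^ (α - 1) * mittagLeffler 1 α α (-ξ * s ^ α)) t) := by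
  have hpos : ∀ k : ℕ, 0 < α * k + α := fun k => by positivity
  obtain ⟨C, hC⟩ := hh.2 t
  set F : ℕ → ℝ → ℝ := fun k s =>
    (-ξ) ^ k * ((Ici 0).indicator h s * fracKernel (α * k + α) (t - s)) with hF
  have hFint : ∀ k, Integrable (F k) := fun k =>
    (hh.integrable_mul_fracKernel (hpos k) t).const_mul _
  have hsum : Summable fun k => ∫ s, ‖F k s‖ := by
    refine Summable.of_nonneg_of_le (fun k => by positivity) (fun k => ?_)
      ((summable_pow_div_Gamma hα0 hα1 (add_pos hα0 one_pos) (|ξ| * t ^ α)).mul_left (C * t ^ α))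
    have hI := (integrable_fracKernel_mul_fracKernel_sub one_pos (hpos k) t).const_mul C
    have h1 : ∫ s, ‖F k s‖ ≤ |ξ| ^ k * (C * fracKernel (1 + (α * k + α)) t) := by
      rw [← integral_fracKernel_mul_fracKernel_sub one_pos (hpos k), ← integral_const_mul,
        ← integral_const_mul]
      refine integral_mono_ae (hFint k).norm (hI.const_mul _) ?_
      filter_upwards [ae_norm_indicator_mul_fracKernel_le (hpos k) hC] with s hs
      rw [hF, norm_mul, norm_pow, norm_neg]
      exact mul_le_mul_of_nonneg_left hs (by positivity)
    refine h1.trans ?_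
    have hC0 : 0 ≤ C := (abs_nonneg _).trans (hC 0 ⟨le_rfl, ht⟩)
    have h2 : fracKernel (1 + (α * k + α)) t ≤
        t ^ (α * k) * t ^ α / Real.Gamma (α * k + (α + 1)) := by
      have hG : 0 < Real.Gamma (α * k + (α + 1)) := Real.Gamma_pos_of_pos (by positivity)
      rcases ht.eq_or_lt with rfl | h
      · simp [fracKernel]; positivity
      · rw [← Real.rpow_add h, fracKernel, indicator_of_mem (mem_Ioi.2 h), add_sub_cancel_left,
          show 1 + (α * k + α) = α * k + (α + 1) by ring, div_eq_inv_mul]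
    refine (mul_le_mul_of_nonneg_left (mul_le_mul_of_nonneg_left h2 hC0)
      (by positivity)).trans_eq ?_
    rw [mul_pow, ← Real.rpow_mul_natCast ht]
    ring
  have key := hasSum_integral_of_summable_integral_norm hFint hsum
  have e1 : ∀ k : ℕ, ∫ s, F k s = (-ξ) ^ k * rlIntegral (α * k + α) h t := fun k => by
    rw [hF, integral_const_mul, rlIntegral_eq_integral (hpos k) h ht]
  have e2 : ∫ s, ∑' k, F k s =
      timeConv h (fun s => s ^ (α - 1) * mittagLeffler 1 α α (-ξ * s ^ α)) t := by
    rw [timeConv, intervalIntegral.integral_of_le ht, integral_Ioc_eq_integral_Ioo,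
      ← integral_Ico_eq_integral_Ioo, ← integral_indicator measurableSet_Ico]
    congr with s
    by_cases h0 : 0 ≤ s
    swap
    · simp [hF, h0]
    by_cases h1 : s < t
    swap
    · simp [hF, h1, fracKernel]
    have hts : 0 < t - s := sub_pos.2 h1
    rw [indicator_of_mem (mem_Ico.2 ⟨h0, h1⟩), mittagLeffler_one, ← tsum_mul_left, ← tsum_mul_left]
    congr with k
    simp only [hF, indicator_of_mem (mem_Ici.2 h0), fracKernel, indicator_of_mem (mem_Ioi.2 hts)]
    rw [neg_mul_rpow_pow hts.le, show α * k + α - 1 = (α - 1) + α * k by ring,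
      Real.rpow_add hts]
    ring
  simpa only [e1, e2] using key

/-- Finite resolvent expansion of a linear Volterra equation with a fractional kernel. -/
theorem eq_sum_add_of_volterra {α ξ c : ℝ} (hα0 : 0 < α) {m h : ℝ → ℝ}
    (hm : LocallyBoundedMeasurable m) (hh : LocallyBoundedMeasurable h)
    (heq : ∀ t, 0 ≤ t → m t = c + rlIntegral α (fun s => -ξ * m s + h s) t) (n : ℕ)
    {t : ℝ} (ht : 0 ≤ t) :
    m t = ∑ k ∈ Finset.range n, (c * ((-ξ * t ^ α) ^ k / Real.Gamma (α * k + 1)) +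
      (-ξ) ^ k * rlIntegral (α * k + α) h t) + (-ξ) ^ n * rlIntegral (α * n) m t := by
  have hmh : LocallyBoundedMeasurable fun s => -ξ * m s + h s := (hm.const_mul _).add hh
  induction n with
  | zero => simp [rlIntegral_zero]
  | succ n ih =>
    rw [Finset.sum_range_succ, add_assoc, ih]
    congr 1
    have key : rlIntegral (α * n) m t = c * t ^ (α * n) / Real.Gamma (α * n + 1) +
        (-ξ * rlIntegral (α * n + α) m t + rlIntegral (α * n + α) h t) := by
      have e : rlIntegral (α * n + α) (fun s => -ξ * m s + h s) t =
          -ξ * rlIntegral (α * n + α) m t + rlIntegral (α * n + α) h t := by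
        rw [(hm.const_mul _).rlIntegral_add (by positivity) hh ht, rlIntegral_const_mul]
      rw [← e]
      -- At n = 0 the outer operator is J^0, so the equation itself is the claim.
      rcases n.eq_zero_or_pos with rfl | hn
      · simpa [rlIntegral_zero] using heq t ht
      · have hn' : 0 < α * n := by positivity
        rw [rlIntegral_congr hn' ht (fun s hs => heq s hs.1),
          (LocallyBoundedMeasurable.const c).rlIntegral_add hn' (hmh.rlIntegral hα0) ht,
          rlIntegral_const hn' c ht, rlIntegral_rlIntegral hn' hα0 hmh ht, add_comm α]
    rw [key, neg_mul_rpow_pow ht, show α * ((n + 1 : ℕ) : ℝ) = α * n + α by push_cast; ring,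
      pow_succ]
    ring

/-- This is the Mittag-Leffler series without its constant term 1, divided by -ξ; it collects the
contributions of the constant forcing. -/
theorem hasSum_mittagLeffler_sub_one {α ξ : ℝ} (hα0 : 0 < α) (hα1 : α ≤ 1) (hξ : ξ ≠ 0)
    {t : ℝ} (ht : 0 ≤ t) :
    HasSum (fun k : ℕ => (-ξ) ^ k * (t ^ (α * k + α) / Real.Gamma (α * k + α + 1)))
      ((1 - mittagLeffler 1 α 1 (-ξ * t ^ α)) / ξ) := by
  have h := (hasSum_nat_add_iff' 1).2 (hasSum_mittagLeffler_one hα0 hα1 one_pos (-ξ * t ^ α))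
  have e : -1 / ξ * (mittagLeffler 1 α 1 (-ξ * t ^ α) -
      ∑ i ∈ Finset.range 1, (-ξ * t ^ α) ^ i / Real.Gamma (α * i + 1)) =
      (1 - mittagLeffler 1 α 1 (-ξ * t ^ α)) / ξ := by
    simp only [Finset.range_one, Finset.sum_singleton, pow_zero, Nat.cast_zero, mul_zero, zero_add,
      Real.Gamma_one]
    ring
  rw [← e]
  refine (h.mul_left (-1 / ξ)).congr_fun fun k => ?_
  rw [neg_mul_rpow_pow ht, show α * ((k + 1 : ℕ) : ℝ) = α * k + α by push_cast; ring, pow_succ]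
  field_simp

/-- The solution of the Volterra equation `m = c + J^α (-ξ m + b + μ p)`. -/
theorem eq_mittagLeffler_of_volterra {α ξ c b μ : ℝ} (hα0 : 0 < α) (hα1 : α ≤ 1) (hξ : ξ ≠ 0)
    {m p : ℝ → ℝ} (hm : LocallyBoundedMeasurable m) (hp : LocallyBoundedMeasurable p)
    (heq : ∀ t, 0 ≤ t → m t = c + rlIntegral α (fun s => -ξ * m s + (b + μ * p s)) t)
    {t : ℝ} (ht : 0 ≤ t) :
    m t = c * mittagLeffler 1 α 1 (-ξ * t ^ α)
      + μ * timeConv p (fun s => s ^ (α - 1) * mittagLeffler 1 α α (-ξ * s ^ α)) t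
      + b / ξ * (1 - mittagLeffler 1 α 1 (-ξ * t ^ α)) := by
  have hexp := fun n => eq_sum_add_of_volterra hα0 hm
    ((LocallyBoundedMeasurable.const b).add (hp.const_mul μ)) heq n ht
  -- With |m| ≤ C on [0, t], the remainder is at most C (|ξ| t^α)^n / Γ(αn+1), the general term of a
  -- convergent series.
  have hrem : Tendsto (fun n : ℕ => (-ξ) ^ n * rlIntegral (α * n) m t) atTop (𝓝 0) := by
    obtain ⟨C, hC⟩ := hm.2 t
    have h0 := ((summable_pow_div_Gamma hα0 hα1 one_pos (|ξ| * t ^ α)).mul_left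
      C).tendsto_atTop_zero
    refine squeeze_zero_norm' ?_ h0
    filter_upwards [eventually_gt_atTop 0] with n hn
    have := abs_rlIntegral_le (f := m) (a := α * n) (by positivity) ht hC
    rw [norm_mul, norm_pow, norm_neg, Real.norm_eq_abs, mul_pow, ← Real.rpow_mul_natCast ht]
    refine (mul_le_mul_of_nonneg_left this (by positivity)).trans_eq ?_
    ring
  have hs := ((hasSum_mittagLeffler_one hα0 hα1 one_pos (-ξ * t ^ α)).mul_left c).add
    (((hasSum_mittagLeffler_sub_one hα0 hα1 hξ ht).mul_left b).add
      ((hasSum_pow_mul_rlIntegral hα0 hα1 ξ hp ht).mul_left μ))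
  have hlim := hs.tendsto_sum_nat.add hrem
  have hm_lim := tendsto_nhds_unique (tendsto_const_nhds (x := m t)) (hlim.congr fun n => by
    rw [hexp n]
    congr 1
    refine Finset.sum_congr rfl fun k _ => ?_
    rw [(LocallyBoundedMeasurable.const b).rlIntegral_add (by positivity) (hp.const_mul μ) ht,
      rlIntegral_const (by positivity) b ht, rlIntegral_const_mul]
    ring)
  rw [hm_lim]
  ring

/-! ### Tail probabilities and the mean -/

section Queue

variable {Ω : Type*} [MeasurableSpace Ω]

/-- The tail probabilities `P(X_t > n | X_0 = i)`. -/
noncomputable def tailProb (P : Measure Ω) (X : ℝ≥0 → Ω → ℕ) (i n : ℕ) (t : ℝ) : ℝ :=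
  (ProbabilityTheory.cond P (X 0 ⁻¹' {i})).real {ω | n < X t.toNNReal ω}

variable {P : Measure Ω} {X : ℝ≥0 → Ω → ℕ} {i : ℕ}

theorem transProb_nonneg (n : ℕ) (t : ℝ) : 0 ≤ transProb P X i n t := measureReal_nonneg

theorem tailProb_nonneg (n : ℕ) (t : ℝ) : 0 ≤ tailProb P X i n t := measureReal_nonneg

theorem tailProb_succ (hX : ∀ t, Measurable (X t)) (n : ℕ) (t : ℝ) :
    tailProb P X i (n + 1) t = tailProb P X i n t - transProb P X i (n + 1) t := by
  rw [tailProb, tailProb, transProb,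
    ← measureReal_sdiff _ (hX _ (measurableSet_singleton (n + 1)))]
  · congr 1
    ext ω
    simp only [mem_ofPred_eq, Set.mem_sdiff, mem_preimage, mem_singleton_iff]
    omega
  · intro ω hω
    simp only [mem_preimage, mem_singleton_iff] at hω
    simp [hω]

/-- The expectation is the sum of the tail probabilities. -/
theorem integrable_and_integral_eq_tsum (hX : ∀ t, Measurable (X t)) (t : ℝ)
    (hs : Summable fun n => tailProb P X i n t) :
    Integrable (fun ω => (X t.toNNReal ω : ℝ)) (ProbabilityTheory.cond P (X 0 ⁻¹' {i})) ∧
    ∫ ω, (X t.toNNReal ω : ℝ) ∂(ProbabilityTheory.cond P (X 0 ⁻¹' {i})) =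
      ∑' n, tailProb P X i n t := by
  set ν := ProbabilityTheory.cond P (X 0 ⁻¹' {i}) with hν
  set Y := X t.toNNReal with hY
  have hYm : Measurable fun ω => (Y ω : ℝ) := measurable_from_nat.comp (hX _)
  have hset : ∀ n, MeasurableSet {ω | n < Y ω} := fun n => hX _ (measurableSet_Ioi (a := n))
  -- Layer-cake formula: a natural number Y is the number of n with n < Y.
  have h1 : ∀ ω, ENNReal.ofReal (Y ω) = ∑' n, ({ω | n < Y ω}.indicator 1 ω : ENNReal) := by
    intro ω
    rw [tsum_eq_sum (s := Finset.range (Y ω))]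
    · rw [Finset.sum_congr rfl (g := fun _ => (1 : ENNReal))]
      · simp
      · intro n hn
        simp [Finset.mem_range.1 hn]
    · intro n hn
      have : ¬ n < Y ω := fun h => hn (Finset.mem_range.2 h)
      simp [this]
  have h2 : ∫⁻ ω, ENNReal.ofReal (Y ω) ∂ν = ENNReal.ofReal (∑' n, tailProb P X i n t) := by
    rw [ENNReal.ofReal_tsum_of_nonneg (fun n => tailProb_nonneg n t) hs]
    simp_rw [h1]
    rw [lintegral_tsum fun n => (measurable_one.indicator (hset n)).aemeasurable]
    congr with n
    rw [lintegral_indicator_one (hset n), tailProb, ofReal_measureReal]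
  have h0 : 0 ≤ᵐ[ν] fun ω => (Y ω : ℝ) := Eventually.of_forall fun ω => Nat.cast_nonneg _
  refine ⟨⟨hYm.aestronglyMeasurable, ?_⟩, ?_⟩
  · rw [hasFiniteIntegral_iff_ofReal h0, h2]
    exact ENNReal.ofReal_lt_top
  · rw [integral_eq_lintegral_of_nonneg_ae h0 hYm.aestronglyMeasurable, h2,
      ENNReal.toReal_ofReal (tsum_nonneg fun n => tailProb_nonneg n t)]

variable [IsProbabilityMeasure P]

theorem tailProb_zero (hX : ∀ t, Measurable (X t)) (hi : P (X 0 ⁻¹' {i}) ≠ 0) (t : ℝ) :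
    tailProb P X i 0 t = 1 - transProb P X i 0 t := by
  have := ProbabilityTheory.cond_isProbabilityMeasure hi
  rw [transProb, ← probReal_compl_eq_one_sub (hX _ (measurableSet_singleton 0)), tailProb]
  congr 1
  ext ω
  simp [Nat.pos_iff_ne_zero]

theorem sum_transProb (hX : ∀ t, Measurable (X t)) (hi : P (X 0 ⁻¹' {i}) ≠ 0) (n : ℕ) (t : ℝ) :
    ∑ k ∈ Finset.range (n + 1), transProb P X i k t = 1 - tailProb P X i n t := by
  induction n with
  | zero => simp [tailProb_zero hX hi]
  | succ n ih =>
    rw [Finset.sum_range_succ, ih, tailProb_succ hX]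
    ring

theorem sum_transProb_le_one (hX : ∀ t, Measurable (X t)) (hi : P (X 0 ⁻¹' {i}) ≠ 0) (n : ℕ)
    (t : ℝ) : ∑ k ∈ Finset.range n, transProb P X i k t ≤ 1 := by
  cases n with
  | zero => simp
  | succ n => linarith [sum_transProb hX hi n t, tailProb_nonneg (P := P) (X := X) (i := i) n t]

theorem sum_transProb_succ_le_one (hX : ∀ t, Measurable (X t)) (hi : P (X 0 ⁻¹' {i}) ≠ 0) (n : ℕ)
    (t : ℝ) : ∑ k ∈ Finset.range n, transProb P X i (k + 1) t ≤ 1 := by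
  have h1 := Finset.sum_range_succ' (fun k => transProb P X i k t) n
  have h2 := transProb_nonneg (P := P) (X := X) (i := i) 0 t
  linarith [sum_transProb_le_one hX hi (n + 1) t]

end Queue

/-! ### Volterra equations for the queue -/

namespace IsFractionalQueue

variable {Ω : Type*} [MeasurableSpace Ω] {P : Measure Ω}
  {α lam μ ξ : ℝ} {X : ℝ≥0 → Ω → ℕ} {i : ℕ}

theorem transProb_zero_eq (hX : IsFractionalQueue α lam μ ξ P X) (hα0 : 0 < α) (hα1 : α ≤ 1)
    (hi : P (X 0 ⁻¹' {i}) ≠ 0) {t : ℝ} (ht : 0 ≤ t) :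
    transProb P X i 0 t = (if i = 0 then 1 else 0) + rlIntegral α (fun s =>
      -(lam + ξ) * transProb P X i 0 s + μ * transProb P X i 1 s + ξ) t := by
  rw [← hX.initial i hi 0]
  refine eq_add_rlIntegral_of_hasCaputoDerivAt hα0 hα1 (hX.continuousOn i hi 0) ?_
    (hX.caputo_zero i hi) ht
  exact ((continuousOn_const.mul (hX.continuousOn i hi 0)).add
    (continuousOn_const.mul (hX.continuousOn i hi 1))).add continuousOn_const

theorem transProb_succ_eq (hX : IsFractionalQueue α lam μ ξ P X) (hα0 : 0 < α) (hα1 : α ≤ 1)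
    (hi : P (X 0 ⁻¹' {i}) ≠ 0) (n : ℕ) {t : ℝ} (ht : 0 ≤ t) :
    transProb P X i (n + 1) t = (if i = n + 1 then 1 else 0) + rlIntegral α (fun s =>
      -(lam + μ + ξ) * transProb P X i (n + 1) s + lam * transProb P X i n s
        + μ * transProb P X i (n + 2) s) t := by
  rw [← hX.initial i hi (n + 1)]
  refine eq_add_rlIntegral_of_hasCaputoDerivAt hα0 hα1 (hX.continuousOn i hi (n + 1)) ?_
    (hX.caputo_pos i hi (n + 1) n.succ_pos) ht
  exact ((continuousOn_const.mul (hX.continuousOn i hi (n + 1))).add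
    (continuousOn_const.mul (hX.continuousOn i hi n))).add
    (continuousOn_const.mul (hX.continuousOn i hi (n + 2)))

variable [IsProbabilityMeasure P]

theorem continuousOn_tailProb (hX : IsFractionalQueue α lam μ ξ P X)
    (hi : P (X 0 ⁻¹' {i}) ≠ 0) (n : ℕ) : ContinuousOn (tailProb P X i n) (Ici 0) := by
  have : tailProb P X i n = fun t => 1 - ∑ k ∈ Finset.range (n + 1), transProb P X i k t := by
    ext t
    rw [sum_transProb hX.measurable hi, sub_sub_cancel]
  rw [this]
  exact continuousOn_const.sub (continuousOn_finsetSum _ fun k _ => hX.continuousOn i hi k)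

/-- Subtracting the equation for p_{n+1} from that for T_n telescopes the birth and death terms and
turns -ξ T_n into -ξ T_{n+1}. The base case is T_0 = 1 - p_0, where the source ξ in the equation for
p_0 is absorbed. -/
theorem tailProb_eq (hX : IsFractionalQueue α lam μ ξ P X) (hα0 : 0 < α) (hα1 : α ≤ 1)
    (hi : P (X 0 ⁻¹' {i}) ≠ 0) (n : ℕ) {t : ℝ} (ht : 0 ≤ t) :
    tailProb P X i n t = (if n < i then 1 else 0) + rlIntegral α (fun s =>
      -ξ * tailProb P X i n s + lam * transProb P X i n s + -μ * transProb P X i (n + 1) s) t := by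
  have hp := fun n => LocallyBoundedMeasurable.of_continuousOn (hX.continuousOn i hi n)
  induction n with
  | zero =>
    have hsum := rlIntegral_const_mul α (-1) (fun s =>
      -(lam + ξ) * transProb P X i 0 s + μ * transProb P X i 1 s + ξ) t
    rw [tailProb_zero hX.measurable hi, hX.transProb_zero_eq hα0 hα1 hi ht]
    have e : (fun s => -1 * (-(lam + ξ) * transProb P X i 0 s + μ * transProb P X i 1 s + ξ)) =
        fun s => -ξ * tailProb P X i 0 s + lam * transProb P X i 0 s +
          -μ * transProb P X i (0 + 1) s := by
      ext s
      rw [tailProb_zero hX.measurable hi]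
      ring
    rw [← e, hsum]
    rcases i.eq_zero_or_pos with rfl | h
    · simp
    · simp [h.ne', h]
      ring
  | succ n ih =>
    have hv : LocallyBoundedMeasurable fun s => -(lam + μ + ξ) * transProb P X i (n + 1) s +
        lam * transProb P X i n s + μ * transProb P X i (n + 2) s :=
      (((hp _).const_mul _).add ((hp _).const_mul _)).add ((hp _).const_mul _)
    have hw : LocallyBoundedMeasurable fun s => -ξ * tailProb P X i n s +
        lam * transProb P X i n s + -μ * transProb P X i (n + 1) s :=
      (((LocallyBoundedMeasurable.of_continuousOn (hX.continuousOn_tailProb hi n)).const_mul _).add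
        ((hp _).const_mul _)).add ((hp _).const_mul _)
    have hsum := hw.rlIntegral_add hα0 (hv.const_mul (-1)) ht
    rw [rlIntegral_const_mul] at hsum
    have e : (fun s => (-ξ * tailProb P X i n s + lam * transProb P X i n s +
          -μ * transProb P X i (n + 1) s) + -1 * (-(lam + μ + ξ) * transProb P X i (n + 1) s +
          lam * transProb P X i n s + μ * transProb P X i (n + 2) s)) =
        fun s => -ξ * tailProb P X i (n + 1) s + lam * transProb P X i (n + 1) s +
          -μ * transProb P X i (n + 1 + 1) s := by
      ext s
      rw [tailProb_succ hX.measurable]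
      ring
    rw [e] at hsum
    rw [hsum, tailProb_succ hX.measurable, ih, hX.transProb_succ_eq hα0 hα1 hi n ht]
    have hif : (if n < i then (1 : ℝ) else 0) - (if i = n + 1 then 1 else 0) =
        if n + 1 < i then 1 else 0 := by
      split_ifs <;> first | omega | norm_num
    rw [← hif]
    ring

/-- The Volterra equation for the truncated mean, `∑ n < K, P(X_t > n) = E[min (X_t) K]`. -/
theorem sum_tailProb_eq (hX : IsFractionalQueue α lam μ ξ P X) (hα0 : 0 < α) (hα1 : α ≤ 1)
    (hi : P (X 0 ⁻¹' {i}) ≠ 0) (K : ℕ) {t : ℝ} (ht : 0 ≤ t) :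
    ∑ n ∈ Finset.range K, tailProb P X i n t = (min i K : ℕ) + rlIntegral α (fun s =>
      -ξ * ∑ n ∈ Finset.range K, tailProb P X i n s +
        lam * ∑ n ∈ Finset.range K, transProb P X i n s +
        -μ * ∑ n ∈ Finset.range K, transProb P X i (n + 1) s) t := by
  induction K with
  | zero => simp [rlIntegral_const hα0 0 ht]
  | succ K ih =>
    have hp := fun n => LocallyBoundedMeasurable.of_continuousOn (hX.continuousOn i hi n)
    have hw : LocallyBoundedMeasurable fun s => -ξ * tailProb P X i K s +
        lam * transProb P X i K s + -μ * transProb P X i (K + 1) s :=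
      (((LocallyBoundedMeasurable.of_continuousOn (hX.continuousOn_tailProb hi K)).const_mul _).add
        ((hp _).const_mul _)).add ((hp _).const_mul _)
    have hv : LocallyBoundedMeasurable fun s => -ξ * ∑ n ∈ Finset.range K, tailProb P X i n s +
        lam * ∑ n ∈ Finset.range K, transProb P X i n s +
        -μ * ∑ n ∈ Finset.range K, transProb P X i (n + 1) s :=
      .of_continuousOn (((continuousOn_const.mul (continuousOn_finsetSum _ fun n _ =>
        hX.continuousOn_tailProb hi n)).add (continuousOn_const.mul (continuousOn_finsetSum _
        fun n _ => hX.continuousOn i hi n))).add (continuousOn_const.mul (continuousOn_finsetSum _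
        fun n _ => hX.continuousOn i hi (n + 1))))
    have hsum := hv.rlIntegral_add hα0 hw ht
    rw [Finset.sum_range_succ, ih, hX.tailProb_eq hα0 hα1 hi K ht]
    have e : (fun s => -ξ * ∑ n ∈ Finset.range (K + 1), tailProb P X i n s +
        lam * ∑ n ∈ Finset.range (K + 1), transProb P X i n s +
        -μ * ∑ n ∈ Finset.range (K + 1), transProb P X i (n + 1) s) =
        fun s => (-ξ * ∑ n ∈ Finset.range K, tailProb P X i n s +
        lam * ∑ n ∈ Finset.range K, transProb P X i n s +
        -μ * ∑ n ∈ Finset.range K, transProb P X i (n + 1) s) + (-ξ * tailProb P X i K s +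
        lam * transProb P X i K s + -μ * transProb P X i (K + 1) s) := by
      ext s
      simp only [Finset.sum_range_succ]
      ring
    rw [e, hsum]
    have hif : ((min i K : ℕ) : ℝ) + (if K < i then (1 : ℝ) else 0) = (min i (K + 1) : ℕ) := by
      split_ifs with h
      · rw [min_eq_right h.le, min_eq_right h]
        push_cast
        ring
      · rw [min_eq_left (by omega), min_eq_left (by omega), add_zero]
    rw [← hif]
    ring

/-- Catastrophes and services only lower the truncated mean, and arrivals contribute at rate at most
λ. Independence of K gives finiteness of the mean. -/
theorem sum_tailProb_le (hX : IsFractionalQueue α lam μ ξ P X) (hα0 : 0 < α) (hα1 : α ≤ 1)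
    (hlam : 0 ≤ lam) (hμ : 0 ≤ μ) (hξ : 0 ≤ ξ) (hi : P (X 0 ⁻¹' {i}) ≠ 0) (K : ℕ)
    {t : ℝ} (ht : 0 ≤ t) :
    ∑ n ∈ Finset.range K, tailProb P X i n t ≤ i + lam * t ^ α / Real.Gamma (α + 1) := by
  rw [hX.sum_tailProb_eq hα0 hα1 hi K ht, ← rlIntegral_const hα0 lam ht]
  refine add_le_add (by exact_mod_cast min_le_left i K)
    (rlIntegral_mono hα0 (.of_continuousOn ?_) (.const lam) ht fun s hs => ?_)
  · exact ((continuousOn_const.mul (continuousOn_finsetSum _ fun n _ =>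
      hX.continuousOn_tailProb hi n)).add (continuousOn_const.mul (continuousOn_finsetSum _
      fun n _ => hX.continuousOn i hi n))).add (continuousOn_const.mul (continuousOn_finsetSum _
      fun n _ => hX.continuousOn i hi (n + 1)))
  · have h1 := mul_nonneg hξ (Finset.sum_nonneg fun n (_ : n ∈ Finset.range K) =>
      tailProb_nonneg (P := P) (X := X) (i := i) n s)
    have h2 := mul_nonneg hμ (Finset.sum_nonneg fun n (_ : n ∈ Finset.range K) =>
      transProb_nonneg (P := P) (X := X) (i := i) (n + 1) s)
    have h3 := mul_le_of_le_one_right hlam (sum_transProb_le_one hX.measurable hi K s)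
    linarith

theorem summable_tailProb (hX : IsFractionalQueue α lam μ ξ P X) (hα0 : 0 < α) (hα1 : α ≤ 1)
    (hlam : 0 ≤ lam) (hμ : 0 ≤ μ) (hξ : 0 ≤ ξ) (hi : P (X 0 ⁻¹' {i}) ≠ 0) {t : ℝ} (ht : 0 ≤ t) :
    Summable fun n => tailProb P X i n t :=
  summable_of_sum_range_le (fun n => tailProb_nonneg n t)
    fun K => hX.sum_tailProb_le hα0 hα1 hlam hμ hξ hi K ht

theorem exists_sum_tailProb_bound (hX : IsFractionalQueue α lam μ ξ P X) (hα0 : 0 < α)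
    (hα1 : α ≤ 1) (hlam : 0 ≤ lam) (hμ : 0 ≤ μ) (hξ : 0 ≤ ξ) (hi : P (X 0 ⁻¹' {i}) ≠ 0) (T : ℝ) :
    ∃ C, 0 ≤ C ∧ ∀ K, ∀ s ∈ Icc 0 T, |∑ n ∈ Finset.range K, tailProb P X i n s| ≤ C := by
  have hG := Real.Gamma_pos_of_pos (add_pos hα0 one_pos)
  rcases lt_or_ge T 0 with hT | hT
  · exact ⟨0, le_rfl, fun K s hs => absurd (hs.1.trans hs.2) hT.not_ge⟩
  refine ⟨i + lam * T ^ α / Real.Gamma (α + 1), by positivity, fun K s hs => ?_⟩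
  rw [abs_of_nonneg (Finset.sum_nonneg fun n _ => tailProb_nonneg n s)]
  refine (hX.sum_tailProb_le hα0 hα1 hlam hμ hξ hi K hs.1).trans ?_
  have := Real.rpow_le_rpow hs.1 hs.2 hα0.le
  gcongr

theorem locallyBoundedMeasurable_mean (hX : IsFractionalQueue α lam μ ξ P X) (hα0 : 0 < α)
    (hα1 : α ≤ 1) (hlam : 0 ≤ lam) (hμ : 0 ≤ μ) (hξ : 0 ≤ ξ) (hi : P (X 0 ⁻¹' {i}) ≠ 0) :
    LocallyBoundedMeasurable fun t => ∑' n, tailProb P X i n t :=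
  .of_tendsto (f := fun K t => ∑ n ∈ Finset.range K, tailProb P X i n t)
    (fun _ => .of_continuousOn (continuousOn_finsetSum _ fun n _ => hX.continuousOn_tailProb hi n))
    (fun T => (hX.exists_sum_tailProb_bound hα0 hα1 hlam hμ hξ hi T).imp fun _ h => h.2)
    fun _ ht => (hX.summable_tailProb hα0 hα1 hlam hμ hξ hi ht).hasSum.tendsto_sum_nat

/-- The mean of the queue solves a linear fractional Volterra equation. -/
theorem mean_eq (hX : IsFractionalQueue α lam μ ξ P X) (hα0 : 0 < α) (hα1 : α ≤ 1)
    (hlam : 0 ≤ lam) (hμ : 0 ≤ μ) (hξ : 0 ≤ ξ) (hi : P (X 0 ⁻¹' {i}) ≠ 0) {t : ℝ} (ht : 0 ≤ t) :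
    ∑' n, tailProb P X i n t = i + rlIntegral α (fun s => -ξ * ∑' n, tailProb P X i n s +
      (lam - μ + μ * transProb P X i 0 s)) t := by
  have hS : ∀ s, 0 ≤ s → Tendsto (fun K => ∑ n ∈ Finset.range K, tailProb P X i n s) atTop
      (𝓝 (∑' n, tailProb P X i n s)) := fun s hs =>
    (hX.summable_tailProb hα0 hα1 hlam hμ hξ hi hs).hasSum.tendsto_sum_nat
  have hA1 : ∀ s, 0 ≤ s → Tendsto (fun K => ∑ n ∈ Finset.range (K + 1), transProb P X i n s) atTop
      (𝓝 1) := fun s hs => by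
    simp_rw [sum_transProb hX.measurable hi]
    -- Total mass one follows from the summable tails tending to 0.
    simpa using (hX.summable_tailProb hα0 hα1 hlam hμ hξ hi hs).tendsto_atTop_zero.const_sub 1
  have hA : ∀ s, 0 ≤ s → Tendsto (fun K => ∑ n ∈ Finset.range K, transProb P X i n s) atTop
      (𝓝 1) := fun s hs => (tendsto_add_atTop_iff_nat 1).1 (hA1 s hs)
  have hB : ∀ s, 0 ≤ s → Tendsto (fun K => ∑ n ∈ Finset.range K, transProb P X i (n + 1) s) atTop
      (𝓝 (1 - transProb P X i 0 s)) := fun s hs => by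
    refine ((hA1 s hs).sub_const _).congr fun K => ?_
    rw [Finset.sum_range_succ', add_sub_cancel_right]
  obtain ⟨C, hC0, hC⟩ := hX.exists_sum_tailProb_bound hα0 hα1 hlam hμ hξ hi t
  -- The constant bounds the three terms separately: truncated means by C, partial sums of
  -- probabilities by 1.
  have hJ := tendsto_rlIntegral hα0 (t := t) (C := ξ * C + lam * 1 + μ * 1)
    (f := fun K s => -ξ * ∑ n ∈ Finset.range K, tailProb P X i n s +
        lam * ∑ n ∈ Finset.range K, transProb P X i n s +
        -μ * ∑ n ∈ Finset.range K, transProb P X i (n + 1) s)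
    (g := fun s => -ξ * ∑' n, tailProb P X i n s + (lam - μ + μ * transProb P X i 0 s))
    (fun K => .of_continuousOn (((continuousOn_const.mul (continuousOn_finsetSum _ fun n _ =>
        hX.continuousOn_tailProb hi n)).add (continuousOn_const.mul (continuousOn_finsetSum _
        fun n _ => hX.continuousOn i hi n))).add (continuousOn_const.mul (continuousOn_finsetSum _
        fun n _ => hX.continuousOn i hi (n + 1))))) ht
    (fun K s hs => by
      refine (abs_add_le _ _).trans (add_le_add ((abs_add_le _ _).trans (add_le_add ?_ ?_)) ?_)
      · rw [abs_mul, abs_neg, abs_of_nonneg hξ]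
        exact mul_le_mul_of_nonneg_left (hC K s hs) hξ
      · rw [abs_mul, abs_of_nonneg hlam,
          abs_of_nonneg (Finset.sum_nonneg fun n _ => transProb_nonneg _ _)]
        exact mul_le_mul_of_nonneg_left (sum_transProb_le_one hX.measurable hi K s) hlam
      · rw [abs_mul, abs_neg, abs_of_nonneg hμ,
          abs_of_nonneg (Finset.sum_nonneg fun n _ => transProb_nonneg _ _)]
        exact mul_le_mul_of_nonneg_left (sum_transProb_succ_le_one hX.measurable hi K s) hμ)
    (fun s hs => by
      have := (((hS s hs).const_mul (-ξ)).add ((hA s hs).const_mul lam)).add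
        ((hB s hs).const_mul (-μ))
      convert this using 2
      ring)
  have hmin : Tendsto (fun K => ((min i K : ℕ) : ℝ)) atTop (𝓝 i) := by
    refine tendsto_const_nhds.congr' ?_
    filter_upwards [eventually_ge_atTop i] with K hK
    rw [min_eq_left hK]
  exact tendsto_nhds_unique ((hS t ht).congr fun K => hX.sum_tailProb_eq hα0 hα1 hi K ht)
    (hmin.add hJ)

end IsFractionalQueue

/-! ### The mean formulas -/

theorem mainTheorem3 {Ω : Type*} [MeasurableSpace Ω] (P : Measure Ω) [IsProbabilityMeasure P]
    (α lam μ ξ : ℝ) (hα0 : 0 < α) (hα1 : α ≤ 1) (hlam : 0 < lam) (hμ : 0 < μ) (hξ : 0 ≤ ξ)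
    (X : ℝ≥0 → Ω → ℕ) (hX : IsFractionalQueue α lam μ ξ P X)
    (i : ℕ) (hi : P (X 0 ⁻¹' {i}) ≠ 0) (t : ℝ≥0) :
    Integrable (fun ω => (X t ω : ℝ)) (ProbabilityTheory.cond P (X 0 ⁻¹' {i})) ∧
    IntervalIntegrable (fun s : ℝ => transProb P X i 0 s *
      ((t - s) ^ (α - 1) * mittagLeffler 1 α α (-ξ * (t - s) ^ α))) volume 0 t ∧
    (0 < ξ →
      ∫ ω, (X t ω : ℝ) ∂(ProbabilityTheory.cond P (X 0 ⁻¹' {i})) =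
        i * mittagLeffler 1 α 1 (-ξ * (t : ℝ) ^ α)
        + μ * timeConv (transProb P X i 0)
            (fun s => s ^ (α - 1) * mittagLeffler 1 α α (-ξ * s ^ α)) t
        + (lam - μ) / ξ * (1 - mittagLeffler 1 α 1 (-ξ * (t : ℝ) ^ α))) ∧
    (ξ = 0 →
      ∫ ω, (X t ω : ℝ) ∂(ProbabilityTheory.cond P (X 0 ⁻¹' {i})) =
        i + μ * rlIntegral α (transProb P X i 0) t
        + (lam - μ) * (t : ℝ) ^ α / Real.Gamma (α + 1)) ∧
    (α = 1 → 0 < ξ →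
      ∫ ω, (X t ω : ℝ) ∂(ProbabilityTheory.cond P (X 0 ⁻¹' {i})) =
        i * Real.exp (-ξ * t)
        + μ * timeConv (transProb P X i 0) (fun s => Real.exp (-ξ * s)) t
        + (lam - μ) / ξ * (1 - Real.exp (-ξ * t))) := by
  have ht : (0 : ℝ) ≤ t := t.coe_nonneg
  have hp := LocallyBoundedMeasurable.of_continuousOn (hX.continuousOn i hi 0)
  have hm := hX.locallyBoundedMeasurable_mean hα0 hα1 hlam.le hμ.le hξ hi
  have hmean : ∀ t : ℝ, 0 ≤ t → _ := fun t ht => hX.mean_eq hα0 hα1 hlam.le hμ.le hξ hi ht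
  obtain ⟨hint, hE⟩ := integrable_and_integral_eq_tsum hX.measurable (t : ℝ)
    (hX.summable_tailProb hα0 hα1 hlam.le hμ.le hξ hi ht)
  rw [Real.toNNReal_coe] at hint hE
  have hpos : 0 < ξ → ∫ ω, (X t ω : ℝ) ∂(ProbabilityTheory.cond P (X 0 ⁻¹' {i})) =
      i * mittagLeffler 1 α 1 (-ξ * (t : ℝ) ^ α)
      + μ * timeConv (transProb P X i 0)
          (fun s => s ^ (α - 1) * mittagLeffler 1 α α (-ξ * s ^ α)) t
      + (lam - μ) / ξ * (1 - mittagLeffler 1 α 1 (-ξ * (t : ℝ) ^ α)) := fun h => by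
    rw [hE]
    exact eq_mittagLeffler_of_volterra hα0 hα1 h.ne' hm hp hmean ht
  refine ⟨hint, intervalIntegrable_mul_mittagLeffler hα0 hα1 ξ (hX.continuousOn i hi 0) ht, hpos,
    fun h => ?_, fun h1 h => ?_⟩
  -- With ξ = 0 the unknown mean drops out of the right-hand side of the Volterra equation.
  · rw [hE, hmean t ht, h]
    simp only [neg_zero, zero_mul, zero_add]
    rw [(LocallyBoundedMeasurable.const (lam - μ)).rlIntegral_add hα0 (hp.const_mul μ) ht,
      rlIntegral_const hα0 _ ht, rlIntegral_const_mul]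
    ring
  · subst h1
    rw [hpos h]
    simp only [Real.rpow_one, sub_self, Real.rpow_zero, one_mul, mittagLeffler_one_one_one]
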